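/- **Lemma (Preservation of Atoms).** Let $\mathcal C$ be the set of terms built by binary application from the constants $\mathbf s$, $\mathbf k$, free variables $x_i$ ($i\in\omega$), atoms $\xi_i$ ($i>0$), and a constant $\zeta_F$ for each bijection $F:\omega_{>0}\to\omega_{>0}$. Let $I=\mathbf s\mathbf k\mathbf k$ and let the numerals be $\underline 0=I$, $\underline{n+1}=\mathbf s(\mathbf s I(\mathbf k(\mathbf kI)))(\mathbf k\,\underline n)$ (that is, $\lambda z.\,z(\mathbf kI)\underline n$). The reduction rules, applicable to any subterm, are $$\mathbf s xyz\to xz(yz),\qquad \mathbf kxy\to x,\qquad \zeta_F t\to\underline n\quad(t\text{ closed}),$$ where $n$ is the largest $F(m)$ such that $\xi_m$ occurs in $t$, or $n=0$ if no atom occurs in $t$. A normal form is a term to which no rule can be applied. Define partial operators $\mathrm{RED}_n$ on $\mathcal C$ as follows; the clauses are tried in order. - $\mathrm{RED}_0(t)=t$ if $t$ is a normal form; $\mathrm{RED}_0(\mathbf k r u)=r$ if $r,u$ are normal forms; $\mathrm{RED}_0(\zeta_F r)=\underline n$ with $n$ as in the $\zeta$-rule if $r$ is a normal form; otherwise $\mathrm{RED}_0(t)$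 is undefined. - $\mathrm{RED}_{n+1}(t)=\mathrm{RED}_n(t)$ if the latter is defined; $\mathrm{RED}_{n+1}(\mathbf s r u v)\simeq\mathrm{RED}_n(\mathrm{RED}_n(rv)\,\mathrm{RED}_n(uv))$ if $r,u,v$ are normal forms; in all other cases $\mathrm{RED}_{n+1}(ru)\simeq\mathrm{RED}_n(\mathrm{RED}_n(r)\,\mathrm{RED}_n(u))$. Let $\mathrm{RED}=\bigcup_n\mathrm{RED}_n$, and let $\mathcal T$ be the set of closed normal forms with the partial application $a.b:\simeq\mathrm{RED}(ab)$. An element $f\in\mathcal T$ is *type 1* if for every $n\in\omega$ there is $m\in\omega$ with $f.\underline n=\underline m$; $e\in\mathcal T$ is *type 2* if for every type 1 $f$, $e.f$ is defined and type 1; $e$ is a *type 2 identity* if it is type 2 and $(e.f).\underline n=f.\underline n$ for all type 1 $f$ and all $n\in\omega$. Let $e$ be a type 2 identity in $\mathcal T$. Then for every $n>0$ there is a type 1 element $f\in\mathcal T$ such that no atom other than $\xi_n$ occurs in $f$, and the atom $\xi_n$ occurs in $e.f=\mathrm{RED}(ef)$. Moreover every atom occurring in $e.f$ is $\xi_n$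 or occurs in $e$. -/

import Mathlib

namespace AtomPca

/-- Terms of combinatory logic with free variables `x_i`, atoms `ξ_i` (`i > 0`) and a constant
`ζ_F` for every bijection `F` of the positive integers. -/
inductive Term : Type
  | s : Term
  | k : Term
  | var (i : ℕ) : Term
  | xi (i : ℕ+) : Term
  | zeta (F : ℕ+ ≃ ℕ+) : Term
  | app (L M : Term) : Term

infixl:75 " ⬝ " => Term.app

namespace Term

/-- The term contains no free variable. -/
def Closed : Term → Prop
  | var _ => False
  | app L M => Closed L ∧ Closed M
  | _ => True

/-- The set of indices `i` such that the atom `ξ_i` occurs in the term. -/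
def atoms : Term → Finset ℕ+
  | xi i => {i}
  | app L M => atoms L ∪ atoms M
  | _ => ∅

/-- The identity combinator. -/
def I : Term := s ⬝ k ⬝ k

/-- The numerals: `0` is `I`, and `n + 1` is the pair of `k I` ("false") and `n`, that is,
the term `λ z. z (k I) n`. -/
def numeral : ℕ → Term
  | 0 => I
  | n + 1 => s ⬝ (s ⬝ I ⬝ (k ⬝ (k ⬝ I))) ⬝ (k ⬝ numeral n)

/-- The largest `F m` such that `ξ_m` occurs in `t`, and `0` if no atom occurs in `t`. -/
def zetaVal (F : ℕ+ ≃ ℕ+) (t : Term) : ℕ := t.atoms.sup fun m => (F m : ℕ)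

/-- One-step reduction, applied anywhere in a term. -/
inductive Step : Term → Term → Prop
  | s (x y z : Term) : Step (s ⬝ x ⬝ y ⬝ z) (x ⬝ z ⬝ (y ⬝ z))
  | k (x y : Term) : Step (k ⬝ x ⬝ y) x
  | zeta (F : ℕ+ ≃ ℕ+) (t : Term) (ht : t.Closed) : Step (zeta F ⬝ t) (numeral (zetaVal F t))
  | left {L L' : Term} (M : Term) (h : Step L L') : Step (L ⬝ M) (L' ⬝ M)
  | right (L : Term) {M M' : Term} (h : Step M M') : Step (L ⬝ M) (L ⬝ M')

/-- A normal form is a term to which no reduction rule can be applied. -/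
def IsNormal (t : Term) : Prop := ∀ u, ¬ Step t u

open Classical in
/-- The stage `RED_0`. The clauses are tried in the order in which they are listed. -/
noncomputable def redZero (t : Term) : Option Term :=
  if IsNormal t then some t
  else
    match t with
    | k ⬝ r ⬝ u => if IsNormal r ∧ IsNormal u then some r else none
    | zeta F ⬝ r => if IsNormal r then some (numeral (zetaVal F r)) else none
    | _ => none

/-- `R (R a R b)`: both parts of an application are reduced by `R`, then the result is. -/
def redApp (R : Term → Option Term) (a b : Term) : Option Term :=
  (R a).bind fun a' => (R b).bind fun b' => R (a' ⬝ b')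

open Classical in
/-- The clauses of the stage `RED_{n+1}` for a term on which `R = RED_n` is undefined. -/
noncomputable def redNext (R : Term → Option Term) : Term → Option Term
  | s ⬝ r ⬝ u ⬝ v =>
    if IsNormal r ∧ IsNormal u ∧ IsNormal v then redApp R (r ⬝ v) (u ⬝ v)
    else redApp R (s ⬝ r ⬝ u) v
  | r ⬝ u => redApp R r u
  | _ => none

/-- The stages `RED_n` of leftmost-innermost reduction, as partial operators on terms. -/
noncomputable def redN : ℕ → Term → Option Term
  | 0, t => redZero t
  | n + 1, t =>
    match redN n t with
    | some v => some v
    | none => redNext (redN n) t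

theorem redN_succ {n : ℕ} {t v : Term} (h : redN n t = some v) : redN (n + 1) t = some v := by
  simp [redN, h]

theorem redN_mono {m n : ℕ} (hmn : m ≤ n) {t v : Term} (h : redN m t = some v) :
    redN n t = some v := by
  induction n, hmn using Nat.le_induction with
  | base => exact h
  | succ n _ ih => exact redN_succ ih

theorem redN_unique {m n : ℕ} {t v w : Term} (hv : redN m t = some v) (hw : redN n t = some w) :
    v = w := by
  have h1 := redN_mono (le_max_left m n) hv
  have h2 := redN_mono (le_max_right m n) hw
  exact Option.some.inj (h1.symm.trans h2)

/-- Leftmost-innermost reduction `RED`, the union of the stages `RED_n`. -/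
noncomputable def red (t : Term) : Part Term where
  Dom := ∃ n v, redN n t = some v
  get h := h.choose_spec.choose

theorem mem_red {t v : Term} : v ∈ red t ↔ ∃ n, redN n t = some v := by
  constructor
  · rintro ⟨h, rfl⟩
    exact ⟨_, h.choose_spec.choose_spec⟩
  · rintro ⟨n, hn⟩
    have h : ∃ n v, redN n t = some v := ⟨n, v, hn⟩
    exact ⟨h, redN_unique h.choose_spec.choose_spec hn⟩

theorem numeral_closed (n : ℕ) : (numeral n).Closed := by
  induction n with
  | zero => simp [numeral, I, Closed]
  | succ n ih => simp [numeral, I, Closed, ih]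

theorem numeral_isNormal (n : ℕ) : (numeral n).IsNormal := by
  have hs : IsNormal s := by intro u h; cases h
  have hk : IsNormal k := by intro u h; cases h
  have hk1 : ∀ {a}, IsNormal a → IsNormal (k ⬝ a) := by
    intro a ha u h
    cases h with
    | left _ h => exact hk _ h
    | right _ h => exact ha _ h
  have hs1 : ∀ {a}, IsNormal a → IsNormal (s ⬝ a) := by
    intro a ha u h
    cases h with
    | left _ h => exact hs _ h
    | right _ h => exact ha _ h
  have hs2 : ∀ {a b}, IsNormal a → IsNormal b → IsNormal (s ⬝ a ⬝ b) := by
    intro a b ha hb u h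
    cases h with
    | left _ h => exact hs1 ha _ h
    | right _ h => exact hb _ h
  have hI : IsNormal I := hs2 hk hk
  induction n with
  | zero => exact hI
  | succ n ih => exact hs2 (hs2 hI (hk1 (hk1 hI))) (hk1 ih)

theorem redN_isNormal {n : ℕ} {t v : Term} (h : redN n t = some v) : v.IsNormal := by
  induction n generalizing t v with
  | zero =>
    have hn := numeral_isNormal
    simp only [redN, redZero] at h
    grind
  | succ n ih =>
    rw [redN] at h
    split at h
    · rename_i w hw
      obtain rfl := Option.some.inj h
      exact ih hw
    · unfold redNext at h
      split at h <;> grind [redApp, Option.bind_eq_some_iff]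

theorem redApp_closed {R : Term → Option Term}
    (hR : ∀ {t v : Term}, t.Closed → R t = some v → v.Closed) {a b v : Term}
    (ha : a.Closed) (hb : b.Closed) (h : redApp R a b = some v) : v.Closed := by
  obtain ⟨a', ha', h⟩ := Option.bind_eq_some_iff.1 h
  obtain ⟨b', hb', h⟩ := Option.bind_eq_some_iff.1 h
  exact hR (t := a' ⬝ b') ⟨hR ha ha', hR hb hb'⟩ h

theorem redN_closed {n : ℕ} {t v : Term} (ht : t.Closed) (h : redN n t = some v) :
    v.Closed := by
  induction n generalizing t v with
  | zero =>
    have hn := numeral_closed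
    simp only [redN, redZero] at h
    grind [Closed]
  | succ n ih =>
    rw [redN] at h
    split at h
    · rename_i w hw
      obtain rfl := Option.some.inj h
      exact ih ht hw
    · unfold redNext at h
      split at h
      · rename_i r u x _
        obtain ⟨⟨⟨_, hr⟩, hu⟩, hx⟩ := ht
        split_ifs at h
        · exact redApp_closed ih (a := r ⬝ x) (b := u ⬝ x) ⟨hr, hx⟩ ⟨hu, hx⟩ h
        · exact redApp_closed ih (a := s ⬝ r ⬝ u) ⟨⟨trivial, hr⟩, hu⟩ hx h
      · exact redApp_closed ih ht.1 ht.2 h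
      · cases h

end Term

/-- The elements of the pca `𝒯`: the closed normal forms. -/
def T : Type := {t : Term // t.Closed ∧ t.IsNormal}

namespace T

/-- The underlying term of an element of `𝒯`. -/
def term (a : T) : Term := Subtype.val a

/-- The application of `𝒯`: `a . b` is `RED (a b)`, and is undefined where the latter is. -/
noncomputable def app (a b : T) : Part T where
  Dom := (Term.red (a.term ⬝ b.term)).Dom
  get h := ⟨(Term.red (a.term ⬝ b.term)).get h, by
    obtain ⟨n, hn⟩ := Term.mem_red.1 (Part.get_mem h)
    exact ⟨Term.redN_closed (show Term.Closed (a.term ⬝ b.term) from ⟨a.2.1, b.2.1⟩) hn,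
      Term.redN_isNormal hn⟩⟩

/-- The numerals as elements of `𝒯`. -/
def num (n : ℕ) : T := ⟨Term.numeral n, Term.numeral_closed n, Term.numeral_isNormal n⟩

/-- `f` maps every numeral to a numeral. -/
def IsType1 (f : T) : Prop := ∀ n : ℕ, ∃ m : ℕ, num m ∈ app f (num n)

/-- `e` maps every type 1 element to a type 1 element. -/
def IsType2 (e : T) : Prop := ∀ f : T, IsType1 f → ∃ g ∈ app e f, IsType1 g

/-- `e` is type 2, and `e f n = f n` for all type 1 elements `f` and all `n`. -/
def IsType2Identity (e : T) : Prop :=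
  IsType2 e ∧ ∀ f : T, IsType1 f → ∀ n : ℕ,
    ((app e f).bind fun g => app g (num n)) = app f (num n)

end T

end AtomPca

namespace AtomPca

namespace Term

@[simp] theorem isNormal_s : IsNormal s := by intro u h; cases h

@[simp] theorem isNormal_k : IsNormal k := by intro u h; cases h

@[simp] theorem isNormal_xi (i : ℕ+) : IsNormal (xi i) := by intro u h; cases h

theorem isNormal_app {a b : Term} : IsNormal (a ⬝ b) ↔ IsNormal a ∧ IsNormal b ∧
    (∀ x y, a ≠ s ⬝ x ⬝ y) ∧ (∀ x, a ≠ k ⬝ x) ∧ ∀ F, a = zeta F → ¬ b.Closed := by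
  constructor
  · intro h
    refine ⟨fun u hu => h _ (.left _ hu), fun u hu => h _ (.right _ hu), ?_, ?_, ?_⟩
    · rintro x y rfl
      exact h _ (.s x y b)
    · rintro x rfl
      exact h _ (.k x b)
    · rintro F rfl hb
      exact h _ (.zeta F b hb)
  · rintro ⟨ha, hb, hs, hk, hz⟩ u hu
    cases hu with
    | s x y => exact hs x y rfl
    | k x => exact hk _ rfl
    | zeta F _ ht => exact hz F rfl ht
    | left _ h => exact ha _ h
    | right _ h => exact hb _ h

@[simp] theorem isNormal_s_app {a : Term} : IsNormal (s ⬝ a) ↔ IsNormal a := by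
  simp [isNormal_app]

@[simp] theorem isNormal_s_app_app {a b : Term} :
    IsNormal (s ⬝ a ⬝ b) ↔ IsNormal a ∧ IsNormal b := by
  simp [isNormal_app]

@[simp] theorem isNormal_k_app {a : Term} : IsNormal (k ⬝ a) ↔ IsNormal a := by
  simp [isNormal_app]

@[simp] theorem isNormal_I : IsNormal I := numeral_isNormal 0

@[simp] theorem isNormal_numeral (i : ℕ) : IsNormal (numeral i) := numeral_isNormal i

/-- Big-step presentation of leftmost-innermost reduction. -/
inductive Ev : Term → Term → Prop
  | normal {t : Term} (ht : IsNormal t) : Ev t t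
  | k {r u : Term} (hr : IsNormal r) (hu : IsNormal u) : Ev (k ⬝ r ⬝ u) r
  | zeta (F : ℕ+ ≃ ℕ+) {r : Term} (hr : IsNormal r) (hc : r.Closed) :
      Ev (zeta F ⬝ r) (numeral (zetaVal F r))
  | s {r u v a b c : Term} (hr : IsNormal r) (hu : IsNormal u) (hv : IsNormal v)
      (ha : Ev (r ⬝ v) a) (hb : Ev (u ⬝ v) b) (hc : Ev (a ⬝ b) c) : Ev (s ⬝ r ⬝ u ⬝ v) c
  | app {r u a b c : Term} (h : ¬ (IsNormal r ∧ IsNormal u))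
      (ha : Ev r a) (hb : Ev u b) (hc : Ev (a ⬝ b) c) : Ev (r ⬝ u) c

theorem redApp_eq_some {R : Term → Option Term} {a b c : Term} :
    redApp R a b = some c ↔ ∃ a' b', R a = some a' ∧ R b = some b' ∧ R (a' ⬝ b') = some c := by
  simp only [redApp, Option.bind_eq_some_iff]
  grind

theorem redN_of_isNormal {t : Term} (ht : IsNormal t) (n : ℕ) : redN n t = some t :=
  redN_mono (Nat.zero_le n) (by simp [redN, redZero, ht])

theorem redNext_mono {R S : Term → Option Term} (h : ∀ t v, R t = some v → S t = some v)
    {t v : Term} (ht : redNext R t = some v) : redNext S t = some v := by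
  have key : ∀ a b, redApp R a b = some v → redApp S a b = some v := by
    intro a b hab
    obtain ⟨a', b', h1, h2, h3⟩ := redApp_eq_some.1 hab
    exact redApp_eq_some.2 ⟨a', b', h _ _ h1, h _ _ h2, h _ _ h3⟩
  unfold redNext at ht ⊢
  split at ht
  · split_ifs at ht ⊢ <;> exact key _ _ ht
  · exact key _ _ ht
  · cases ht

theorem redNext_of_redN {t : Term} (h0 : redZero t = none) (n : ℕ) {v : Term}
    (h : redN n t = some v) : redNext (redN n) t = some v := by
  induction n with
  | zero => simp [redN, h0] at h
  | succ n ih =>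
    refine redNext_mono (fun _ _ => redN_succ) ?_
    rw [redN] at h
    split at h
    · rename_i w hw
      obtain rfl := Option.some.inj h
      exact ih hw
    · exact h

theorem redN_succ_of_redNext {t v : Term} (h0 : redZero t = none) {n : ℕ}
    (h : redNext (redN n) t = some v) : redN (n + 1) t = some v := by
  rw [redN]
  split
  · rename_i w hw
    exact (redNext_of_redN h0 n hw).symm.trans h
  · exact h

theorem ev_of_redN {n : ℕ} {t v : Term} (h : redN n t = some v) : Ev t v := by
  induction n generalizing t v with
  | zero =>
    simp only [redN, redZero] at h
    split_ifs at h with hn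
    · obtain rfl := Option.some.inj h
      exact .normal hn
    · split at h
      · split_ifs at h with hru
        obtain rfl := Option.some.inj h
        exact .k hru.1 hru.2
      · rename_i F r
        split_ifs at h with hr
        obtain rfl := Option.some.inj h
        refine .zeta F hr ?_
        by_contra hc
        refine hn (isNormal_app.2 ⟨?_, hr, ?_, ?_, fun _ _ => hc⟩)
        · intro u hu
          cases hu
        · simp
        · simp
      · cases h
  | succ n ih =>
    rw [redN] at h
    split at h
    · rename_i w hw
      obtain rfl := Option.some.inj h
      exact ih hw
    · rename_i hnone
      have key : ∀ a b, redN n (a ⬝ b) = none → redApp (redN n) a b = some v →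
          Ev (a ⬝ b) v := by
        intro a b hab hv
        obtain ⟨a', b', h1, h2, h3⟩ := redApp_eq_some.1 hv
        refine .app ?_ (ih h1) (ih h2) (ih h3)
        rintro ⟨ha, hb⟩
        rw [redN_of_isNormal ha] at h1
        rw [redN_of_isNormal hb] at h2
        cases h1
        cases h2
        rw [hab] at h3
        cases h3
      unfold redNext at h
      split at h
      · split_ifs at h with hn
        · obtain ⟨a', b', h1, h2, h3⟩ := redApp_eq_some.1 h
          exact .s hn.1 hn.2.1 hn.2.2 (ih h1) (ih h2) (ih h3)
        · exact key _ _ hnone h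
      · exact key _ _ hnone h
      · cases h

theorem Ev.exists_redN {t v : Term} (h : Ev t v) : ∃ n, redN n t = some v := by
  have combine : ∀ {a b a' b' c : Term}, (∃ n, redN n a = some a') → (∃ n, redN n b = some b') →
      (∃ n, redN n (a' ⬝ b') = some c) → ∃ n, redApp (redN n) a b = some c := by
    rintro a b a' b' c ⟨n1, h1⟩ ⟨n2, h2⟩ ⟨n3, h3⟩
    exact ⟨max n1 (max n2 n3), redApp_eq_some.2 ⟨a', b', redN_mono (by simp) h1,
      redN_mono (by simp) h2, redN_mono (by simp) h3⟩⟩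
  induction h with
  | normal ht => exact ⟨0, redN_of_isNormal ht 0⟩
  | k hr hu =>
    refine ⟨0, ?_⟩
    simp [redN, redZero, hr, hu, isNormal_app]
  | zeta F hr hc =>
    refine ⟨0, ?_⟩
    simp [redN, redZero, hr, hc, isNormal_app]
  | s hr hu hv _ _ _ iha ihb ihc =>
    obtain ⟨n, hn⟩ := combine iha ihb ihc
    refine ⟨n + 1, redN_succ_of_redNext ?_ ?_⟩
    · simp [redZero, isNormal_app]
    · simpa [redNext, hr, hu, hv] using hn
  | @app r u a b c h _ _ _ iha ihb ihc =>
    obtain ⟨n, hn⟩ := combine iha ihb ihc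
    refine ⟨n + 1, redN_succ_of_redNext ?_ ?_⟩
    · have hn : ¬ IsNormal (r ⬝ u) := fun hn => h ⟨(isNormal_app.1 hn).1, (isNormal_app.1 hn).2.1⟩
      simp only [redZero, hn, if_false]
      split
      · rename_i heq
        cases heq
        simpa using h
      · rename_i F _ heq
        cases heq
        have hz : IsNormal (Term.zeta F) := by intro u h; cases h
        simpa [hz] using h
      · rfl
    · unfold redNext
      split
      · rename_i heq
        cases heq
        rw [if_neg]
        · exact hn
        · simpa [and_assoc] using h
      · rename_i heq
        cases heq
        exact hn
      · rename_i hne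
        exact absurd rfl (hne _ _)

theorem mem_red_iff_ev {t v : Term} : v ∈ red t ↔ Ev t v :=
  mem_red.trans ⟨fun ⟨_, h⟩ => ev_of_redN h, Ev.exists_redN⟩

theorem Ev.unique {t v w : Term} (hv : Ev t v) (hw : Ev t w) : v = w := by
  obtain ⟨_, h1⟩ := hv.exists_redN
  obtain ⟨_, h2⟩ := hw.exists_redN
  exact redN_unique h1 h2

theorem Ev.comp {r u a b c : Term} (ha : Ev r a) (hb : Ev u b) (hc : Ev (a ⬝ b) c) :
    Ev (r ⬝ u) c := by
  by_cases h : IsNormal r ∧ IsNormal u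
  · obtain rfl := ha.unique (.normal h.1)
    obtain rfl := hb.unique (.normal h.2)
    exact hc
  · exact .app h ha hb hc

theorem Ev.isNormal {t v : Term} (h : Ev t v) : IsNormal v := by
  obtain ⟨_, h⟩ := h.exists_redN
  exact redN_isNormal h

/-- Evaluation of `s r u v` when the result of evaluating `r v` and `u v` is already normal. -/
theorem Ev.s_normal {r u v a b : Term} (hr : IsNormal r) (hu : IsNormal u) (hv : IsNormal v)
    (ha : Ev (r ⬝ v) a) (hb : Ev (u ⬝ v) b) (hab : IsNormal (a ⬝ b)) :
    Ev (Term.s ⬝ r ⬝ u ⬝ v) (a ⬝ b) :=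
  .s hr hu hv ha hb (.normal hab)

theorem ev_I {v : Term} (hv : IsNormal v) : Ev (I ⬝ v) v := by
  refine .s (by simp) (by simp) hv (.normal (by simpa)) (.normal (by simpa)) (.k hv (by simpa))

@[simp] theorem atoms_numeral (i : ℕ) : (numeral i).atoms = ∅ := by
  induction i with
  | zero => simp [numeral, I, atoms]
  | succ i ih => simp [numeral, I, atoms, ih]

/-- Evaluation does not create atoms. -/
theorem Ev.atoms_subset {t v : Term} (h : Ev t v) : v.atoms ⊆ t.atoms := by
  induction h <;> grind [atoms, atoms_numeral]

/-- The term `λ u. u (k I)`; it maps `n + 1` to `n`. -/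
def predTerm : Term := s ⬝ I ⬝ (k ⬝ (k ⬝ I))

/-- A constant function with value the numeral `i`, in which the atom `ξ_n` occurs. -/
def const (n : ℕ+) (i : ℕ) : Term := s ⬝ (k ⬝ (k ⬝ numeral i)) ⬝ (k ⬝ xi n)

/-- The term `λ v. v k (const n 0)`. -/
def zeroTest (n : ℕ+) : Term := s ⬝ (s ⬝ I ⬝ (k ⬝ k)) ⬝ (k ⬝ const n 0)

/-- The term `λ v. v k (const n 0) (λ u. f (u (k I))) v`, which returns `0` on the numeral `0`
and calls `f` on the predecessor otherwise. -/
def descend (n : ℕ+) (f : Term) : Term :=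
  s ⬝ (s ⬝ zeroTest n ⬝ (k ⬝ (s ⬝ (k ⬝ f) ⬝ predTerm))) ⬝ I

/-- The term `λ x. descend n (λ v. x x v)`. -/
def unfolder (n : ℕ+) : Term :=
  s ⬝ (s ⬝ (k ⬝ s) ⬝ (s ⬝ (k ⬝ (s ⬝ zeroTest n)) ⬝ (s ⬝ (k ⬝ k) ⬝
    (s ⬝ (s ⬝ (k ⬝ s) ⬝ (s ⬝ (k ⬝ k) ⬝
      (s ⬝ (s ⬝ (k ⬝ s) ⬝ (s ⬝ (s ⬝ (k ⬝ s) ⬝ k) ⬝ k)) ⬝ (k ⬝ I)))) ⬝ (k ⬝ predTerm))))) ⬝ (k ⬝ I)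

/-- A fixed point of `descend n`: it walks a numeral down to `0`, and then returns `0`. -/
def walk (n : ℕ+) : Term := s ⬝ (s ⬝ (k ⬝ unfolder n) ⬝ (k ⬝ unfolder n)) ⬝ I

/-- The approximation to `walk n` that returns `1` after `j` recursive calls. -/
def walkUpTo (n : ℕ+) : ℕ → Term
  | 0 => const n 1
  | j + 1 => s ⬝ (k ⬝ descend n (walkUpTo n j)) ⬝ I

@[simp] theorem isNormal_predTerm : IsNormal predTerm := by simp [predTerm]

@[simp] theorem isNormal_const (n : ℕ+) (i : ℕ) : IsNormal (const n i) := by simp [const]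

@[simp] theorem isNormal_zeroTest (n : ℕ+) : IsNormal (zeroTest n) := by simp [zeroTest]

@[simp] theorem isNormal_descend {n : ℕ+} {f : Term} : IsNormal (descend n f) ↔ IsNormal f := by
  simp [descend]

@[simp] theorem isNormal_unfolder (n : ℕ+) : IsNormal (unfolder n) := by simp [unfolder]

@[simp] theorem isNormal_walk (n : ℕ+) : IsNormal (walk n) := by simp [walk]

@[simp] theorem isNormal_walkUpTo (n : ℕ+) (j : ℕ) : IsNormal (walkUpTo n j) := by
  induction j with
  | zero => simp [walkUpTo]
  | succ j ih => simp [walkUpTo, ih]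

theorem closed_walk (n : ℕ+) : (walk n).Closed := by
  simp [walk, unfolder, zeroTest, const, predTerm, I, Closed, numeral]

theorem closed_walkUpTo (n : ℕ+) (j : ℕ) : (walkUpTo n j).Closed := by
  induction j with
  | zero => simp [walkUpTo, const, Closed, numeral_closed]
  | succ j ih => simp [walkUpTo, descend, zeroTest, const, predTerm, I, Closed, ih, numeral]

theorem atoms_walk (n : ℕ+) : (walk n).atoms = {n} := by
  simp [walk, unfolder, zeroTest, const, predTerm, I, atoms, numeral]

theorem atoms_walkUpTo (n : ℕ+) (j : ℕ) : (walkUpTo n j).atoms = {n} := by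
  induction j with
  | zero => simp [walkUpTo, const, atoms]
  | succ j ih => simp [walkUpTo, descend, zeroTest, const, predTerm, I, atoms, ih, numeral]

theorem ev_const (n : ℕ+) (i : ℕ) {v : Term} (hv : IsNormal v) :
    Ev (const n i ⬝ v) (numeral i) :=
  .s (by simp) (by simp) hv (.k (by simp) hv) (.k (by simp) hv) (.k (by simp) (by simp))

theorem ev_predTerm {u w : Term} (hu : IsNormal u) (h : Ev (u ⬝ (k ⬝ I)) w) :
    Ev (predTerm ⬝ u) w :=
  .s (by simp) (by simp) hu (ev_I hu) (.k (by simp) hu) h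

theorem ev_descend (n : ℕ+) {f v a b c d : Term} (hf : IsNormal f) (hv : IsNormal v)
    (ha : Ev (v ⬝ k) a) (hb : Ev (a ⬝ const n 0) b)
    (hc : Ev (b ⬝ (s ⬝ (k ⬝ f) ⬝ predTerm)) c) (hd : Ev (c ⬝ v) d) :
    Ev (descend n f ⬝ v) d := by
  refine .s (by simp [hf]) (by simp) hv ?_ (ev_I hv) hd
  refine .s (by simp) (by simp [hf]) hv ?_ (.k (by simp [hf]) hv) hc
  refine .s (by simp) (by simp) hv ?_ (.k (by simp) hv) hb
  exact .s (by simp) (by simp) hv (ev_I hv) (.k (by simp) hv) ha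

theorem ev_numeral_succ (i : ℕ) {z a w : Term} (hz : IsNormal z) (ha : Ev (z ⬝ (k ⬝ I)) a)
    (hw : Ev (a ⬝ numeral i) w) : Ev (numeral (i + 1) ⬝ z) w := by
  refine .s (by simp) (by simp) hz ?_ (.k (by simp) hz) hw
  exact .s (by simp) (by simp) hz (ev_I hz) (.k (by simp) hz) ha

theorem ev_descend_zero (n : ℕ+) {f : Term} (hf : IsNormal f) :
    Ev (descend n f ⬝ numeral 0) (numeral 0) :=
  ev_descend n hf (by simp) (ev_I (by simp)) (.normal (by simp)) (.k (by simp) (by simp [hf]))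
    (ev_const n 0 (by simp))

theorem ev_descend_succ (n : ℕ+) {f w : Term} (hf : IsNormal f) (i : ℕ)
    (h : Ev (f ⬝ numeral i) w) : Ev (descend n f ⬝ numeral (i + 1)) w := by
  refine ev_descend n hf (by simp) (a := k ⬝ I) (b := I) (c := s ⬝ (k ⬝ f) ⬝ predTerm)
    ?_ ?_ ?_ ?_
  · exact ev_numeral_succ i (by simp) (.normal (by simp)) (.k (by simp) (by simp))
  · exact .k (by simp) (by simp)
  · exact ev_I (by simp [hf])
  · refine .s (by simp [hf]) (by simp) (by simp) (.k hf (by simp)) (b := numeral i) ?_ h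
    refine ev_predTerm (by simp) ?_
    exact ev_numeral_succ i (by simp) (a := I) (.k (by simp) (by simp)) (ev_I (by simp))

theorem ev_unfolder (n : ℕ+) {x : Term} (hx : IsNormal x) :
    Ev (unfolder n ⬝ x) (descend n (s ⬝ (s ⬝ (k ⬝ x) ⬝ (k ⬝ x)) ⬝ I)) := by
  have hk : ∀ {a}, IsNormal a → Ev (k ⬝ a ⬝ x) a := fun ha => .k ha hx
  have hkx : Ev (k ⬝ x) (k ⬝ x) := .normal (by simpa)
  have hs : ∀ {p a : Term}, IsNormal p → Ev (p ⬝ x) a →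
      Ev (s ⬝ (k ⬝ s) ⬝ p ⬝ x) (s ⬝ a) := fun hp ha =>
    .s_normal (by simp) hp hx (hk (by simp)) ha (by simpa using ha.isNormal)
  have hkk : ∀ {p a : Term}, IsNormal p → Ev (p ⬝ x) a →
      Ev (s ⬝ (k ⬝ k) ⬝ p ⬝ x) (k ⬝ a) := fun hp ha =>
    .s_normal (by simp) hp hx (hk (by simp)) ha (by simpa using ha.isNormal)
  unfold unfolder descend
  refine .s_normal (by simp) (by simp) hx ?_ (hk (by simp)) (by simp [hx])
  refine hs (by simp) (.s_normal (by simp) (by simp) hx (hk (by simp)) ?_ (by simp [hx]))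
  refine hkk (by simp) (.s_normal (by simp) (by simp) hx ?_ (hk (by simp)) (by simp [hx]))
  refine hs (by simp) (hkk (by simp) ?_)
  refine .s_normal (by simp) (by simp) hx ?_ (hk (by simp)) (by simp [hx])
  exact hs (by simp) (.s_normal (by simp) (by simp) hx (hs (by simp) hkx) hkx (by simp [hx]))

theorem ev_walk_left (n : ℕ+) {v : Term} (hv : IsNormal v) :
    Ev (s ⬝ (k ⬝ unfolder n) ⬝ (k ⬝ unfolder n) ⬝ v) (descend n (walk n)) :=
  .s (by simp) (by simp) hv (.k (by simp) hv) (.k (by simp) hv) (ev_unfolder n (by simp))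

theorem ev_walk (n : ℕ+) {v w : Term} (hv : IsNormal v) (h : Ev (descend n (walk n) ⬝ v) w) :
    Ev (walk n ⬝ v) w :=
  .s (by simp) (by simp) hv (ev_walk_left n hv) (ev_I hv) h

theorem ev_walkUpTo_succ (n : ℕ+) (j : ℕ) {v w : Term} (hv : IsNormal v)
    (h : Ev (descend n (walkUpTo n j) ⬝ v) w) : Ev (walkUpTo n (j + 1) ⬝ v) w :=
  .s (by simp) (by simp) hv (.k (by simp) hv) (ev_I hv) h

theorem ev_walk_numeral (n : ℕ+) (i : ℕ) : Ev (walk n ⬝ numeral i) (numeral 0) := by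
  induction i with
  | zero => exact ev_walk n (by simp) (ev_descend_zero n (by simp))
  | succ i ih => exact ev_walk n (by simp) (ev_descend_succ n (by simp) i ih)

theorem exists_ev_walkUpTo_numeral (n : ℕ+) (j i : ℕ) :
    ∃ m, Ev (walkUpTo n j ⬝ numeral i) (numeral m) := by
  induction j generalizing i with
  | zero => exact ⟨1, ev_const n 1 (by simp)⟩
  | succ j ih =>
    cases i with
    | zero => exact ⟨0, ev_walkUpTo_succ n j (by simp) (ev_descend_zero n (by simp))⟩
    | succ i =>
      obtain ⟨m, hm⟩ := ih i
      exact ⟨m, ev_walkUpTo_succ n j (by simp) (ev_descend_succ n (by simp) i hm)⟩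

theorem ev_walkUpTo_self (n : ℕ+) (j : ℕ) : Ev (walkUpTo n j ⬝ numeral j) (numeral 1) := by
  induction j with
  | zero => exact ev_const n 1 (by simp)
  | succ j ih => exact ev_walkUpTo_succ n j (by simp) (ev_descend_succ n (by simp) j ih)

/-- `Approx n j t t'`: the term `t'` arises from `t` by replacing some occurrences of `walk n` by
approximations `walkUpTo n i` with `j ≤ i`. -/
inductive Approx (n : ℕ+) (j : ℕ) : Term → Term → Prop
  | refl (t : Term) : Approx n j t t
  | app {a a' b b' : Term} (ha : Approx n j a a') (hb : Approx n j b b') :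
      Approx n j (a ⬝ b) (a' ⬝ b')
  | walk {i : ℕ} (hi : j ≤ i) : Approx n j (walk n) (walkUpTo n i)

namespace Approx

variable {n : ℕ+} {i j : ℕ} {t t' : Term}

theorem mono (hij : i ≤ j) (h : Approx n j t t') : Approx n i t t' := by
  induction h with
  | refl t => exact .refl t
  | app _ _ iha ihb => exact .app iha ihb
  | walk h => exact .walk (hij.trans h)

theorem atoms_eq (h : Approx n j t t') : t'.atoms = t.atoms := by
  induction h with
  | refl t => rfl
  | app _ _ iha ihb => simp [atoms, iha, ihb]
  | walk h => rw [atoms_walk, atoms_walkUpTo]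

theorem eq_of_notMem (h : Approx n j t t') (hn : n ∉ t.atoms) : t' = t := by
  induction h with
  | refl t => rfl
  | app _ _ iha ihb =>
    simp only [atoms, Finset.mem_union, not_or] at hn
    rw [iha hn.1, ihb hn.2]
  | walk h => simp [atoms_walk] at hn

theorem closed (h : Approx n j t t') (ht : t.Closed) : t'.Closed := by
  induction h with
  | refl t => exact ht
  | app _ _ iha ihb => exact ⟨iha ht.1, ihb ht.2⟩
  | walk h => exact closed_walkUpTo n _

theorem closed' (h : Approx n j t t') (ht : t'.Closed) : t.Closed := by
  induction h with
  | refl t => exact ht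
  | app _ _ iha ihb => exact ⟨iha ht.1, ihb ht.2⟩
  | walk h => exact closed_walk n

theorem eq_s (h : Approx n j t s) : t = s := by
  generalize hz : s = z at h
  cases h with
  | refl => rfl
  | app => cases hz
  | @walk i hi => cases i <;> cases hz

theorem eq_k (h : Approx n j t k) : t = k := by
  generalize hz : k = z at h
  cases h with
  | refl => rfl
  | app => cases hz
  | @walk i hi => cases i <;> cases hz

theorem exists_of_app {a b : Term} (h : Approx n j (a ⬝ b) t') :
    (∃ a' b', t' = a' ⬝ b' ∧ Approx n j a a' ∧ Approx n j b b') ∨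
      a ⬝ b = Term.walk n ∧ ∃ i, j ≤ i ∧ t' = walkUpTo n i := by
  generalize ht : a ⬝ b = t at h
  cases h with
  | refl => exact .inl ⟨a, b, ht.symm, .refl _, .refl _⟩
  | app ha hb =>
    cases ht
    exact .inl ⟨_, _, rfl, ha, hb⟩
  | walk hi => exact .inr ⟨rfl, _, hi, rfl⟩

theorem exists_of_k_app {a : Term} (h : Approx n j (k ⬝ a) t') :
    ∃ a', t' = k ⬝ a' ∧ Approx n j a a' := by
  obtain ⟨x, a', rfl, hx, ha⟩ | ⟨hw, -⟩ := h.exists_of_app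
  · cases hx
    exact ⟨a', rfl, ha⟩
  · simp [Term.walk] at hw

theorem exists_of_s_app {a : Term} (h : Approx n j (s ⬝ a) t') :
    ∃ a', t' = s ⬝ a' ∧ Approx n j a a' := by
  obtain ⟨x, a', rfl, hx, ha⟩ | ⟨hw, -⟩ := h.exists_of_app
  · cases hx
    exact ⟨a', rfl, ha⟩
  · simp [Term.walk] at hw

theorem isNormal (h : Approx n j t t') (ht : IsNormal t) : IsNormal t' := by
  induction h with
  | refl t => exact ht
  | @app a a' b b' ha hb iha ihb =>
    obtain ⟨h1, h2, h3, h4, h5⟩ := isNormal_app.1 ht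
    refine isNormal_app.2 ⟨iha h1, ihb h2, ?_, ?_, ?_⟩
    · rintro x y rfl
      generalize hz : s ⬝ x ⬝ y = z at ha
      cases ha with
      | refl => exact h3 x y hz.symm
      | @app c c' d d' hc hd =>
        cases hz
        generalize hz : s ⬝ x = z at hc
        cases hc with
        | refl => exact h3 x d (by rw [hz])
        | app hs hx =>
          cases hz
          exact h3 _ _ (by rw [hs.eq_s])
        | @walk i hi => cases i <;> simp [walkUpTo, const] at hz
      | walk hi => exact h3 _ _ rfl
    · rintro x rfl
      generalize hz : k ⬝ x = z at ha
      cases ha with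
      | refl => exact h4 x hz.symm
      | app hc hd =>
        cases hz
        exact h4 _ (by rw [hc.eq_k])
      | @walk i hi => cases i <;> simp [walkUpTo, const] at hz
    · rintro F rfl hc
      generalize hz : zeta F = z at ha
      cases ha with
      | refl => exact h5 F hz.symm (hb.closed' hc)
      | app hc hd => cases hz
      | @walk i hi => cases i <;> simp [walkUpTo, const] at hz
  | walk h => simp

theorem descend {f f' : Term} (h : Approx n j f f') :
    Approx n j (descend n f) (Term.descend n f') :=
  .app (.app (.refl _) (.app (.refl _) (.app (.refl _) (.app (.app (.refl _) (.app (.refl _) h))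
    (.refl _))))) (.refl _)

end Approx

/-- An evaluation is simulated by every sufficiently good approximation of its input. -/
theorem Ev.approx (n : ℕ+) {t w : Term} (h : Ev t w) :
    ∃ c, ∀ j t', Approx n (j + c) t t' → ∃ w', Ev t' w' ∧ Approx n j w w' := by
  induction h with
  | normal ht => exact ⟨0, fun j t' h => ⟨t', .normal (h.isNormal ht), h⟩⟩
  | k hr hu =>
    refine ⟨0, fun j t' h => ?_⟩
    obtain ⟨x, u', rfl, hx, hu'⟩ | ⟨hw, -⟩ := h.exists_of_app
    · obtain ⟨r', rfl, hr'⟩ := hx.exists_of_k_app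
      exact ⟨r', .k (hr'.isNormal hr) (hu'.isNormal hu), hr'⟩
    · simp [walk] at hw
  | zeta F hr hc =>
    refine ⟨0, fun j t' h => ?_⟩
    obtain ⟨x, r', rfl, hx, hr'⟩ | ⟨hw, -⟩ := h.exists_of_app
    · cases hx
      refine ⟨_, .zeta F (hr'.isNormal hr) (hr'.closed hc), ?_⟩
      rw [zetaVal, zetaVal, hr'.atoms_eq]
      exact .refl _
    · simp [walk] at hw
  | @s r u v a b c hr hu hv hea heb hec iha ihb ihc =>
    obtain ⟨ca, iha⟩ := iha
    obtain ⟨cb, ihb⟩ := ihb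
    obtain ⟨cc, ihc⟩ := ihc
    refine ⟨ca + cb + cc + 1, fun j t' h => ?_⟩
    obtain ⟨x, v', rfl, hx, hv'⟩ | ⟨hw, -⟩ := h.exists_of_app
    · obtain ⟨y, u', rfl, hy, hu'⟩ | ⟨hw, i, hi, rfl⟩ := hx.exists_of_app
      · obtain ⟨r', rfl, hr'⟩ := hy.exists_of_s_app
        obtain ⟨a', ha, haa⟩ := iha (j + cc) (r' ⬝ v') ((hr'.app hv').mono (by omega))
        obtain ⟨b', hb, hbb⟩ := ihb (j + cc) (u' ⬝ v') ((hu'.app hv').mono (by omega))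
        obtain ⟨c', hc, hcc⟩ := ihc j _ (haa.app hbb)
        exact ⟨c', .s (hr'.isNormal hr) (hu'.isNormal hu) (hv'.isNormal hv) ha hb hc, hcc⟩
      · obtain ⟨rfl, rfl⟩ : r = _ ∧ u = _ := by simpa [walk] using hw
        obtain rfl := hea.unique (ev_walk_left n hv)
        obtain rfl := heb.unique (ev_I hv)
        obtain ⟨i, rfl⟩ : ∃ l, i = l + 1 := ⟨i - 1, by omega⟩
        obtain ⟨c', hc, hcc⟩ := ihc j (descend n (walkUpTo n i) ⬝ v')
          ((Approx.walk (by omega)).descend.app (hv'.mono (by omega)))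
        exact ⟨c', ev_walkUpTo_succ n i (hv'.isNormal hv) hc, hcc⟩
    · simp [walk] at hw
  | @app r u a b c hn hea heb hec iha ihb ihc =>
    obtain ⟨ca, iha⟩ := iha
    obtain ⟨cb, ihb⟩ := ihb
    obtain ⟨cc, ihc⟩ := ihc
    refine ⟨ca + cb + cc, fun j t' h => ?_⟩
    obtain ⟨r', u', rfl, hr', hu'⟩ | ⟨hw, -⟩ := h.exists_of_app
    · obtain ⟨a', ha, haa⟩ := iha (j + cc) r' (hr'.mono (by omega))
      obtain ⟨b', hb, hbb⟩ := ihb (j + cc) u' (hu'.mono (by omega))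
      obtain ⟨c', hc, hcc⟩ := ihc j _ (haa.app hbb)
      exact ⟨c', ha.comp hb hc, hcc⟩
    · have h := isNormal_walk n
      rw [← hw, isNormal_app] at h
      exact absurd ⟨h.1, h.2.1⟩ hn

end Term

namespace T

theorem mem_app_iff_ev {a b g : T} : g ∈ app a b ↔ Term.Ev (a.term ⬝ b.term) g.term := by
  rw [← Term.mem_red_iff_ev]
  constructor
  · rintro ⟨h, rfl⟩
    exact Part.get_mem (o := Term.red (a.term ⬝ b.term)) h
  · rintro ⟨h, hg⟩
    exact ⟨h, Subtype.ext hg⟩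

/-- The element `walk n` of `𝒯`. -/
def walk (n : ℕ+) : T := ⟨Term.walk n, Term.closed_walk n, Term.isNormal_walk n⟩

/-- The element `walkUpTo n j` of `𝒯`. -/
def walkUpTo (n : ℕ+) (j : ℕ) : T :=
  ⟨Term.walkUpTo n j, Term.closed_walkUpTo n j, Term.isNormal_walkUpTo n j⟩

theorem num_mem_app_walk (n : ℕ+) (i : ℕ) : num 0 ∈ app (walk n) (num i) :=
  mem_app_iff_ev.2 (Term.ev_walk_numeral n i)

theorem isType1_walk (n : ℕ+) : IsType1 (walk n) := fun i => ⟨0, num_mem_app_walk n i⟩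

theorem num_mem_app_walkUpTo (n : ℕ+) (j : ℕ) : num 1 ∈ app (walkUpTo n j) (num j) :=
  mem_app_iff_ev.2 (Term.ev_walkUpTo_self n j)

theorem isType1_walkUpTo (n : ℕ+) (j : ℕ) : IsType1 (walkUpTo n j) := fun i =>
  (Term.exists_ev_walkUpTo_numeral n j i).imp fun _ h => mem_app_iff_ev.2 h

theorem num_zero_ne_num_one : num 0 ≠ num 1 := by
  intro h
  simpa [num, Term.numeral, Term.I] using congrArg Subtype.val h

theorem IsType2Identity.mem_app {e f g w : T} (he : e.IsType2Identity) (hf : f.IsType1)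
    (hg : g ∈ app e f) {i : ℕ} (hw : w ∈ app f (num i)) : w ∈ app g (num i) := by
  rw [← he.2 f hf i, Part.mem_bind_iff] at hw
  obtain ⟨g', hg', hw⟩ := hw
  rwa [Part.mem_unique hg hg']

end T

end AtomPca

open AtomPca in
theorem mainTheorem5 (e : AtomPca.T) (he : e.IsType2Identity) (n : ℕ+) :
    ∃ f : AtomPca.T, f.IsType1 ∧ (∀ i ∈ f.term.atoms, i = n) ∧
      ∃ g ∈ AtomPca.T.app e f, n ∈ g.term.atoms ∧
        ∀ i ∈ g.term.atoms, i = n ∨ i ∈ e.term.atoms := by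
  have hf := T.isType1_walk n
  have hatoms : (T.walk n).term.atoms = {n} := Term.atoms_walk n
  obtain ⟨g, hg, -⟩ := he.1 _ hf
  have hev := T.mem_app_iff_ev.1 hg
  refine ⟨T.walk n, hf, by simp [hatoms], g, hg, ?_, fun i hi => ?_⟩
  · by_contra hn
    obtain ⟨c, hc⟩ := hev.approx n
    have hf' := T.isType1_walkUpTo n c
    obtain ⟨g', hg', -⟩ := he.1 _ hf'
    obtain ⟨w, hw, hgw⟩ := hc 0 (e.term ⬝ (T.walkUpTo n c).term)
      (.app (.refl _) (.walk (Nat.zero_add c).le))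
    have hgg : g' = g := Subtype.ext <|
      ((T.mem_app_iff_ev.1 hg').unique hw).trans (hgw.eq_of_notMem hn)
    subst hgg
    exact T.num_zero_ne_num_one <| Part.mem_unique
      (he.mem_app hf hg (T.num_mem_app_walk n c)) (he.mem_app hf' hg' (T.num_mem_app_walkUpTo n c))
  · have := hev.atoms_subset hi
    simpa [Term.atoms, hatoms, or_comm] using this
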